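/- For $d\in\mathbb{N}$ let $\mathcal{M}_d$ be the space of complex $d\times d$ matrices and identify $\mathcal{M}_n\otimes\mathcal{M}_m$ with $\mathcal{M}_{nm}$ via the Kronecker product. Positive means positive semidefinite. A linear map $T:\mathcal{M}_n\to\mathcal{M}_m$ is *completely positive* if $\mathrm{id}_k\otimes T$ maps positive matrices to positive matrices for every $k\in\mathbb{N}$; it is *completely copositive* if $\vartheta_m\circ T$ is completely positive, where $\vartheta_m(X)=X^T$ is the transposition in the computational basis; and it is *entanglement breaking* if for every positive $X\in\mathcal{M}_m\otimes\mathcal{M}_n$ the matrix $(\mathrm{id}_m\otimes T)(X)$ is separable, i.e. belongs to the convex cone generated by the matrices $A\otimes B$ with $A,B\in\mathcal{M}_m$ positive. For a matrix $Y$ write $\mathrm{Ad}_Y(X)=YXY^\dagger$. Proposition. Let $d\in\mathbb{N}$ and let $T_1,T_2:\mathcal{M}_d\otimes\mathcal{M}_d\to\mathcal{M}_d\otimes\mathcal{M}_d$ be linear maps, each of which is completely positive, completely copositive (with respect to the transposition on $\mathcal{M}_d\otimes\mathcal{M}_d\cong\mathcal{M}_{d^2}$), and satisfies $$(\mathrm{Ad}_U\otimes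 \mathrm{Ad}_V)\circ T_i\circ(\mathrm{Ad}_{U^T}\otimes \mathrm{Ad}_{V^\dagger})=T_i\qquad\text{for all unitaries } U,V\in\mathcal{M}_d .$$ Then the composition $T_2\circ T_1$ is entanglement breaking (as a map $\mathcal{M}_{d^2}\to\mathcal{M}_{d^2}$). -/

import Mathlib

open scoped Kronecker ComplexOrder

namespace PPTSquared

/-- The linear map `Ad_Y : X ↦ Y X Y†`. -/
def Ad {m p : Type*} [Fintype m] (Y : Matrix p m ℂ) :
    Matrix m m ℂ →ₗ[ℂ] Matrix p p ℂ where
  toFun X := Y * X * Y.conjTranspose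
  map_add' X X' := by rw [Matrix.mul_add, Matrix.add_mul]
  map_smul' c X := by simp

/-- The block `(⟨i| ⊗ 1) X (|j⟩ ⊗ 1)` of a matrix on a tensor product. -/
def block {m n : Type*} (i j : m) : Matrix (m × n) (m × n) ℂ →ₗ[ℂ] Matrix n n ℂ where
  toFun X := Matrix.of fun a b => X (i, a) (j, b)
  map_add' _ _ := rfl
  map_smul' _ _ := rfl

/-- The tensor product `S ⊗ T` of two linear maps between matrix spaces, where the tensor product
of matrix spaces is realised by the Kronecker product as matrices indexed by pairs:
`(S ⊗ T)(X) = ∑ i j, S(|i⟩⟨j|) ⊗ T(X_{ij})` with `X = ∑ i j, |i⟩⟨j| ⊗ X_{ij}`. -/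
def tensorMap {m n p q : Type*} [Fintype m] [DecidableEq m]
    (S : Matrix m m ℂ →ₗ[ℂ] Matrix p p ℂ) (T : Matrix n n ℂ →ₗ[ℂ] Matrix q q ℂ) :
    Matrix (m × n) (m × n) ℂ →ₗ[ℂ] Matrix (p × q) (p × q) ℂ :=
  ∑ i : m, ∑ j : m,
    ((Matrix.kroneckerBilinear (R := ℂ) (α := ℂ) :
        Matrix p p ℂ →ₗ[ℂ] Matrix q q ℂ →ₗ[ℂ] Matrix (p × q) (p × q) ℂ)
      (S (Matrix.single i j 1))) ∘ₗ T ∘ₗ block i j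

/-- `tensorMap S T` acts on product matrices as `A ⊗ B ↦ S(A) ⊗ T(B)`. -/
theorem tensorMap_kronecker {m n p q : Type*} [Fintype m] [DecidableEq m]
    (S : Matrix m m ℂ →ₗ[ℂ] Matrix p p ℂ) (T : Matrix n n ℂ →ₗ[ℂ] Matrix q q ℂ)
    (A : Matrix m m ℂ) (B : Matrix n n ℂ) :
    tensorMap S T (A ⊗ₖ B) = S A ⊗ₖ T B := by
  have hb : ∀ i j : m, block i j (A ⊗ₖ B) = A i j • B := fun i j => rfl
  have hA : S A = ∑ i, ∑ j, A i j • S (Matrix.single i j 1) := by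
    conv_lhs => rw [Matrix.matrix_eq_sum_single A]
    simp only [map_sum]
    refine Finset.sum_congr rfl fun i _ => Finset.sum_congr rfl fun j _ => ?_
    rw [← map_smul, Matrix.smul_single, smul_eq_mul, mul_one]
  ext ⟨a, b⟩ ⟨a', b'⟩
  simp only [tensorMap, LinearMap.sum_apply, LinearMap.comp_apply, hb, map_smul, hA,
    Matrix.sum_apply, Matrix.smul_apply, Matrix.kroneckerMap_apply, smul_eq_mul, Finset.sum_mul]
  refine Finset.sum_congr rfl fun i _ => Finset.sum_congr rfl fun j _ => ?_
  simp [Matrix.kroneckerBilinear, Matrix.kroneckerMapBilinear]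
  ring

/-- `T` maps positive (semidefinite) matrices to positive matrices. -/
def IsPositiveMap {m p : Type*} (T : Matrix m m ℂ →ₗ[ℂ] Matrix p p ℂ) : Prop :=
  ∀ X : Matrix m m ℂ, X.PosSemidef → (T X).PosSemidef

/-- `T` is completely positive: `id_n ⊗ T` is positive for every `n`. -/
def IsCompletelyPositive {m p : Type*} (T : Matrix m m ℂ →ₗ[ℂ] Matrix p p ℂ) : Prop :=
  ∀ n : ℕ, IsPositiveMap
    (tensorMap (LinearMap.id : Matrix (Fin n) (Fin n) ℂ →ₗ[ℂ] Matrix (Fin n) (Fin n) ℂ) T)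

/-- `T` is completely copositive: `ϑ ∘ T` is completely positive, with `ϑ` the transposition. -/
def IsCompletelyCopositive {m p : Type*} (T : Matrix m m ℂ →ₗ[ℂ] Matrix p p ℂ) : Prop :=
  IsCompletelyPositive ((Matrix.transposeLinearEquiv p p ℂ ℂ).toLinearMap ∘ₗ T)

/-- `X` is separable: it lies in the convex cone generated by the product matrices `A ⊗ B` with
`A` and `B` positive. -/
def IsSeparable {m p : Type*} (X : Matrix (m × p) (m × p) ℂ) : Prop :=
  X ∈ PointedCone.hull ℝ
    {Y : Matrix (m × p) (m × p) ℂ |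
      ∃ (A : Matrix m m ℂ) (B : Matrix p p ℂ), A.PosSemidef ∧ B.PosSemidef ∧ Y = A ⊗ₖ B}

/-- `T` is entanglement breaking: `(id ⊗ T)(X)` is separable for every positive `X`, where `id` is
the identity on an ancilla of the same dimension as the output space. -/
def IsEntanglementBreaking {m p : Type*} [Fintype p] [DecidableEq p]
    (T : Matrix m m ℂ →ₗ[ℂ] Matrix p p ℂ) : Prop :=
  ∀ X : Matrix (p × m) (p × m) ℂ, X.PosSemidef →
    IsSeparable (tensorMap (LinearMap.id : Matrix p p ℂ →ₗ[ℂ] Matrix p p ℂ) T X)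

/-- The symmetry `(Ad_U ⊗ Ad_V) ∘ T ∘ (Ad_{Uᵀ} ⊗ Ad_{V†}) = T` for all unitaries `U, V`. -/
def HasUnitarySymmetry {d : ℕ}
    (T : Matrix (Fin d × Fin d) (Fin d × Fin d) ℂ →ₗ[ℂ]
      Matrix (Fin d × Fin d) (Fin d × Fin d) ℂ) : Prop :=
  ∀ U ∈ Matrix.unitaryGroup (Fin d) ℂ, ∀ V ∈ Matrix.unitaryGroup (Fin d) ℂ,
    tensorMap (Ad U) (Ad V) ∘ₗ T ∘ₗ tensorMap (Ad U.transpose) (Ad V.conjTranspose) = T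

end PPTSquared

namespace PPTSquared

open Matrix

/-! For `d ≥ 2` the symmetry leaves only four parameters: `T (X ⊗ Y)` is a combination of `tr X tr Y
1 ⊗ 1`, `tr X 1 ⊗ Y`, `tr Y Xᵀ ⊗ 1` and `Xᵀ ⊗ Y`, with coefficients `a, b, c, e`
(`HasUnitarySymmetry.exists_isSymmetricForm`). With `F` the flip and `Ω` the unnormalized maximally
entangled projection, the Choi matrix is `a + b 1 ⊗ Ω + c F ⊗ 1 + e F ⊗ Ω`. Its eigenvalues give
four linear inequalities. Transposing the output exchanges the two factors' roles, so copositivity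
gives the same four with `b` and `c` swapped (`exists_isPPTCoeff`).

In the composition the two transpositions on the first factor cancel. What remains is a combination
of tensor products of `tr(·) 1` and the identity, hence of the isotropic maps `P = tr(·) 1 + id` and
`M = d tr(·) 1 - id`. Both are measure-and-prepare (`traceMap_add_id_mem`,
`card_smul_traceMap_sub_id_mem`), a property that passes to tensor products and implies entanglement
breaking. It remains to see that the coefficients of `P ⊗ P`, `P ⊗ M`, `M ⊗ P` and `M ⊗ M` are
nonnegative. They are bilinear in the parameters of the two maps, and the `pairing_*` lemmas derive
their signs from the inequalities.

For `d ≤ 1` both maps are nonnegative scalars. -/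

theorem linearMap_ext_kronecker {m n p : Type*} [Fintype m] [DecidableEq m] [Fintype n]
    [DecidableEq n] {S T : Matrix (m × n) (m × n) ℂ →ₗ[ℂ] Matrix p p ℂ}
    (h : ∀ A B, S (A ⊗ₖ B) = T (A ⊗ₖ B)) : S = T := by
  refine ext_linearMap _ fun x y => LinearMap.ext_ring ?_
  obtain ⟨i, k⟩ := x
  obtain ⟨j, l⟩ := y
  have := h (single i j 1) (single k l 1)
  rw [single_kronecker_single] at this
  simpa using this

/-! ### Measure-and-prepare maps -/

/-- Measure `v` and prepare `w`: the map `X ↦ ⟨v|X|v⟩ |w⟩⟨w|`. -/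
noncomputable def rankOneMap {m p : Type*} [Fintype m] (v : m → ℂ) (w : p → ℂ) :
    Matrix m m ℂ →ₗ[ℂ] Matrix p p ℂ where
  toFun X := (star v ⬝ᵥ X *ᵥ v) • vecMulVec w (star w)
  map_add' X Y := by rw [add_mulVec, dotProduct_add, add_smul]
  map_smul' c X := by
    rw [smul_mulVec, dotProduct_smul, smul_assoc, RingHom.id_apply]

theorem rankOneMap_apply {m p : Type*} [Fintype m] (v : m → ℂ) (w : p → ℂ) (X : Matrix m m ℂ) :
    rankOneMap v w X = (star v ⬝ᵥ X *ᵥ v) • vecMulVec w (star w) := rfl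

/-- The cone generated by the maps `X ↦ ⟨v|X|v⟩ |w⟩⟨w|`. -/
noncomputable def measurePrepare (m p : Type*) [Fintype m] :
    PointedCone ℝ (Matrix m m ℂ →ₗ[ℂ] Matrix p p ℂ) :=
  PointedCone.hull ℝ {S | ∃ v w, S = rankOneMap v w}

theorem rankOneMap_mem {m p : Type*} [Fintype m] (v : m → ℂ) (w : p → ℂ) :
    rankOneMap v w ∈ measurePrepare m p :=
  PointedCone.subset_hull ⟨v, w, rfl⟩

theorem measurePrepare_smul_mem {m p : Type*} [Fintype m]
    {S : Matrix m m ℂ →ₗ[ℂ] Matrix p p ℂ} (hS : S ∈ measurePrepare m p) {r : ℝ} (hr : 0 ≤ r) :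
    (r : ℂ) • S ∈ measurePrepare m p := by
  have := (measurePrepare m p).smul_mem hr hS
  convert this using 1
  exact LinearMap.ext fun X => Matrix.ext fun i j => by simp

theorem dotProduct_mul_dotProduct {m n : Type*} [Fintype m] [Fintype n]
    (v w : m → ℂ) (v' w' : n → ℂ) :
    (fun x : m × n => v x.1 * v' x.2) ⬝ᵥ (fun x => w x.1 * w' x.2) = (v ⬝ᵥ w) * (v' ⬝ᵥ w') := by
  simp only [dotProduct, Fintype.sum_prod_type, Finset.sum_mul_sum]
  exact Finset.sum_congr rfl fun i _ => Finset.sum_congr rfl fun j _ => by ring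

theorem kronecker_mulVec_mul {m n p q : Type*} [Fintype m] [Fintype n] (A : Matrix p m ℂ)
    (B : Matrix q n ℂ) (v : m → ℂ) (v' : n → ℂ) :
    (A ⊗ₖ B) *ᵥ (fun x => v x.1 * v' x.2) = fun x => (A *ᵥ v) x.1 * (B *ᵥ v') x.2 := by
  ext x
  exact dotProduct_mul_dotProduct (A x.1) v (B x.2) v'

theorem tensorMap_rankOneMap {m n p q : Type*} [Fintype m] [DecidableEq m] [Fintype n]
    [DecidableEq n] (v : m → ℂ) (w : p → ℂ) (v' : n → ℂ) (w' : q → ℂ) :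
    tensorMap (rankOneMap v w) (rankOneMap v' w') =
      rankOneMap (fun x => v x.1 * v' x.2) (fun x => w x.1 * w' x.2) := by
  refine linearMap_ext_kronecker fun A B => ?_
  rw [tensorMap_kronecker]
  simp only [rankOneMap_apply]
  have key : (star fun x : m × n => v x.1 * v' x.2) ⬝ᵥ (A ⊗ₖ B) *ᵥ (fun x => v x.1 * v' x.2) =
      (star v ⬝ᵥ A *ᵥ v) * (star v' ⬝ᵥ B *ᵥ v') := by
    rw [kronecker_mulVec_mul, ← dotProduct_mul_dotProduct]
    congr 1
    ext x
    simp
  rw [key]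
  ext ⟨a, b⟩ ⟨a', b'⟩
  simp [vecMulVec_apply]
  ring

theorem tensorMap_mem_measurePrepare {m n p q : Type*} [Fintype m] [DecidableEq m] [Fintype n]
    [DecidableEq n] {S : Matrix m m ℂ →ₗ[ℂ] Matrix p p ℂ} {T : Matrix n n ℂ →ₗ[ℂ] Matrix q q ℂ}
    (hS : S ∈ measurePrepare m p) (hT : T ∈ measurePrepare n q) :
    tensorMap S T ∈ measurePrepare (m × n) (p × q) := by
  unfold measurePrepare at hS hT
  induction hS using Submodule.span_induction with
  | mem S h =>
    obtain ⟨v, w, rfl⟩ := h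
    induction hT using Submodule.span_induction with
    | mem T h =>
      obtain ⟨v', w', rfl⟩ := h
      rw [tensorMap_rankOneMap]
      exact rankOneMap_mem _ _
    | zero =>
      convert (measurePrepare (m × n) (p × q)).zero_mem
      exact linearMap_ext_kronecker fun A B => by simp [tensorMap_kronecker]
    | add T T' _ _ h h' =>
      convert (measurePrepare (m × n) (p × q)).add_mem h h'
      exact linearMap_ext_kronecker fun A B => by simp [tensorMap_kronecker, kronecker_add]
    | smul r T _ h =>
      convert (measurePrepare (m × n) (p × q)).smul_mem r.2 h
      exact linearMap_ext_kronecker fun A B => by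
        change _ = (r : ℝ) • tensorMap _ T (A ⊗ₖ B)
        rw [tensorMap_kronecker, tensorMap_kronecker]
        exact kronecker_smul (r : ℝ) _ _
  | zero =>
    convert (measurePrepare (m × n) (p × q)).zero_mem
    exact linearMap_ext_kronecker fun A B => by simp [tensorMap_kronecker]
  | add T T' _ _ h h' =>
    convert (measurePrepare (m × n) (p × q)).add_mem h h'
    exact linearMap_ext_kronecker fun A B => by simp [tensorMap_kronecker, add_kronecker]
  | smul r T _ h =>
    convert (measurePrepare (m × n) (p × q)).smul_mem r.2 h
    exact linearMap_ext_kronecker fun A B => by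
      change _ = (r : ℝ) • tensorMap T _ (A ⊗ₖ B)
      rw [tensorMap_kronecker, tensorMap_kronecker]
      exact smul_kronecker (r : ℝ) _ _

theorem tensorMap_apply {m n p q : Type*} [Fintype m] [DecidableEq m]
    (S : Matrix m m ℂ →ₗ[ℂ] Matrix p p ℂ) (T : Matrix n n ℂ →ₗ[ℂ] Matrix q q ℂ)
    (X : Matrix (m × n) (m × n) ℂ) :
    tensorMap S T X = ∑ i, ∑ j, S (single i j 1) ⊗ₖ T (block i j X) := by
  simp only [tensorMap, LinearMap.sum_apply, LinearMap.comp_apply]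
  rfl

theorem block_apply {m n : Type*} (i j : m) (X : Matrix (m × n) (m × n) ℂ) (a b : n) :
    block i j X a b = X (i, a) (j, b) := rfl

theorem tensorMap_id_apply {n p q : Type*} [Fintype p] [DecidableEq p]
    (T : Matrix n n ℂ →ₗ[ℂ] Matrix q q ℂ) (X : Matrix (p × n) (p × n) ℂ) (i j : p) (a b : q) :
    tensorMap (LinearMap.id : Matrix p p ℂ →ₗ[ℂ] Matrix p p ℂ) T X (i, a) (j, b) =
      T (block i j X) a b := by
  simp only [tensorMap_apply, Matrix.sum_apply, kroneckerMap_apply, LinearMap.id_apply,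
    single_apply, ite_mul, one_mul, zero_mul]
  rw [Finset.sum_eq_single i (by intros; simp [*]) (by simp),
    Finset.sum_eq_single j (by intros; simp [*]) (by simp)]
  simp

theorem isEntanglementBreaking_of_mem_measurePrepare {m p : Type*} [Fintype m] [Fintype p]
    [DecidableEq p] {S : Matrix m m ℂ →ₗ[ℂ] Matrix p p ℂ} (hS : S ∈ measurePrepare m p) :
    IsEntanglementBreaking S := by
  intro X hX
  unfold measurePrepare at hS
  unfold IsSeparable
  induction hS using Submodule.span_induction with
  | mem S h =>
    obtain ⟨v, w, rfl⟩ := h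
    -- `B` is `1 ⊗ |v⟩`, so the ancilla keeps the positive matrix `Bᴴ X B` while the output is
    -- `|w⟩⟨w|`.
    let B : Matrix (p × m) p ℂ := of fun x j => if x.1 = j then v x.2 else 0
    refine PointedCone.subset_hull ⟨Bᴴ * X * B, vecMulVec w (star w),
      hX.conjTranspose_mul_mul_same B, posSemidef_vecMulVec_self_star w, ?_⟩
    ext ⟨i, a⟩ ⟨j, b⟩
    rw [tensorMap_id_apply, rankOneMap_apply]
    simp only [Matrix.smul_apply, kroneckerMap_apply, smul_eq_mul]
    congr 1
    simp only [Matrix.mul_assoc]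
    simp [mul_apply, B, Fintype.sum_prod_type, dotProduct, mulVec, block_apply, apply_ite]
  | zero =>
    convert Submodule.zero_mem _
    ext ⟨i, a⟩ ⟨j, b⟩
    simp [tensorMap_id_apply]
  | add T T' _ _ h h' =>
    convert Submodule.add_mem _ h h'
    ext ⟨i, a⟩ ⟨j, b⟩
    simp [tensorMap_id_apply]
  | smul r T _ h =>
    convert PointedCone.smul_mem _ r.2 h
    ext ⟨i, a⟩ ⟨j, b⟩
    rw [tensorMap_id_apply, Matrix.smul_apply, tensorMap_id_apply]
    rfl

/-! ### The two extremal isotropic maps -/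

/-- The completely depolarizing map `X ↦ tr(X) 1`. -/
def traceMap (n : Type*) [Fintype n] [DecidableEq n] : Matrix n n ℂ →ₗ[ℂ] Matrix n n ℂ :=
  (traceLinearMap n ℂ ℂ).smulRight 1

theorem traceMap_apply {n : Type*} [Fintype n] [DecidableEq n] (X : Matrix n n ℂ) :
    traceMap n X = X.trace • (1 : Matrix n n ℂ) := rfl

theorem rankOneMap_single_apply {m p : Type*} [Fintype m] [DecidableEq m] (v : m → ℂ) (w : p → ℂ)
    (i j : m) (k l : p) :
    rankOneMap v w (single i j 1) k l = star (v i) * v j * (w k * star (w l)) := by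
  rw [rankOneMap_apply, Matrix.smul_apply, vecMulVec_apply, smul_eq_mul]
  congr 1
  simp [dotProduct, mulVec, single_apply, ite_and]

theorem linearMap_ext_single {m p : Type*} [Fintype m] [DecidableEq m]
    {S T : Matrix m m ℂ →ₗ[ℂ] Matrix p p ℂ}
    (h : ∀ i j k l, S (single i j 1) k l = T (single i j 1) k l) : S = T :=
  ext_linearMap _ fun i j => LinearMap.ext_ring (Matrix.ext fun k l => h i j k l)

/-- The fourth roots of unity, indexed by exponent. -/
noncomputable def quarticPhase (k : Fin 4) : ℂ := Complex.I ^ (k : ℕ)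

/-- Orthogonality of characters: shifting one coordinate of `z` permutes the summands and multiplies
each by a fixed scalar `u`, so the sum vanishes as soon as some coordinate gives `u ≠ 1`. -/
theorem sum_four_quarticPhase {n : Type*} [Fintype n] [DecidableEq n] (i j k l : n) :
    ∑ z : n → Fin 4, star (quarticPhase (z i)) * quarticPhase (z j) *
      (quarticPhase (z k) * star (quarticPhase (z l))) =
    if (i = j ∧ k = l) ∨ (i = k ∧ j = l) then (Fintype.card (n → Fin 4) : ℂ) else 0 := by
  have hne : ∀ c : Fin 4, star (quarticPhase c) * quarticPhase c = 1 := by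
    intro c
    fin_cases c <;> simp [quarticPhase, pow_succ]
  split_ifs with h
  · rw [Finset.sum_congr rfl (g := fun _ => (1 : ℂ))]
    · simp
    · rintro z -
      rcases h with ⟨rfl, rfl⟩ | ⟨rfl, rfl⟩
      · rw [mul_comm (quarticPhase (z k)), hne, hne, one_mul]
      · linear_combination (star (quarticPhase (z j)) * quarticPhase (z j)) * hne (z i) + hne (z j)
  · have shift : ∀ c : Fin 4, quarticPhase (c + 1) = Complex.I * quarticPhase c := by
      intro c
      fin_cases c <;> simp [quarticPhase, pow_succ]
    have key : ∀ m : n, ∀ u : ℂ, u ≠ 1 →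
        (if i = m then -Complex.I else 1) * (if j = m then Complex.I else 1) *
          ((if k = m then Complex.I else 1) * (if l = m then -Complex.I else 1)) = u →
        ∑ z : n → Fin 4, star (quarticPhase (z i)) * quarticPhase (z j) *
          (quarticPhase (z k) * star (quarticPhase (z l))) = 0 := by
      intro m u hu hm
      have hs : ∀ (z : n → Fin 4) (a : n), quarticPhase ((z + (Pi.single m 1 : n → Fin 4)) a) =
          (if a = m then Complex.I else 1) * quarticPhase (z a) := by
        intro z a
        by_cases ha : a = m
        · subst ha; simp [shift]
        · simp [ha]
      have := Equiv.sum_comp (Equiv.addRight (Pi.single m (1 : Fin 4)))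
        (fun z : n → Fin 4 => star (quarticPhase (z i)) * quarticPhase (z j) *
          (quarticPhase (z k) * star (quarticPhase (z l))))
      simp only [Equiv.coe_addRight, hs, star_mul'] at this
      have hst : ∀ a : n, star (if a = m then Complex.I else 1 : ℂ) =
          if a = m then -Complex.I else 1 := by
        intro a; split_ifs <;> simp
      simp only [hst] at this
      set s := ∑ z : n → Fin 4, star (quarticPhase (z i)) * quarticPhase (z j) *
          (quarticPhase (z k) * star (quarticPhase (z l))) with hsdef
      have h2 : u * s = s := by
        rw [← hm]
        conv_rhs => rw [← this]
        rw [hsdef, Finset.mul_sum]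
        exact Finset.sum_congr rfl fun z _ => by ring
      have : (u - 1) * s = 0 := by rw [sub_mul, h2, one_mul, sub_self]
      exact (mul_eq_zero.mp this).resolve_left (sub_ne_zero.mpr hu)
    have hI : Complex.I ≠ 1 := fun h => by simpa using congrArg Complex.re h
    have hI' : -Complex.I ≠ 1 := fun h => by simpa using congrArg Complex.re h
    have hm : (-1 : ℂ) ≠ 1 := by norm_num
    by_cases hij : i = j
    · subst hij
      have hkl : k ≠ l := fun h' => h (Or.inl ⟨rfl, h'⟩)
      refine key k Complex.I hI ?_
      by_cases hik : i = k <;> simp [hik, hkl.symm]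
    · by_cases hik : i = k
      · subst hik
        have hjl : j ≠ l := fun h' => h (Or.inr ⟨rfl, h'⟩)
        refine key j Complex.I hI ?_
        simp [hij, hjl.symm]
      · by_cases hil : i = l
        · subst hil
          -- The phase at `i` enters squared here; signs `±1` would not detect it, which is why
          -- fourth roots are used.
          refine key i (-1) hm ?_
          simp [Ne.symm hij, Ne.symm hik]
        · refine key i (-Complex.I) hI' ?_
          simp [Ne.symm hij, Ne.symm hik, Ne.symm hil]

theorem measurePrepare_sum_mem {m p ι : Type*} [Fintype m] (s : Finset ι)
    {S : ι → (Matrix m m ℂ →ₗ[ℂ] Matrix p p ℂ)} (h : ∀ i ∈ s, S i ∈ measurePrepare m p) :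
    ∑ i ∈ s, S i ∈ measurePrepare m p := Submodule.sum_mem _ h

theorem traceMap_single_apply {n : Type*} [Fintype n] [DecidableEq n] (i j k l : n) :
    traceMap n (single i j 1) k l = if i = j ∧ k = l then 1 else 0 := by
  rw [traceMap_apply, Matrix.smul_apply, one_apply, smul_eq_mul]
  by_cases hij : i = j <;> simp [hij, trace_single_eq_of_ne]

/-- The isotropic map `X ↦ tr(X) 1 + X` is measure-and-prepare. -/
theorem traceMap_add_id_mem (n : Type*) [Fintype n] [DecidableEq n] :
    traceMap n + LinearMap.id ∈ measurePrepare n n := by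
  -- Averaging over phase vectors gives `tr(X) 1 + X` with the diagonal of `X` counted once instead
  -- of twice; the second sum restores it.
  have h : traceMap n + LinearMap.id =
      (((Fintype.card (n → Fin 4) : ℝ)⁻¹ : ℝ) : ℂ) •
        (∑ z : n → Fin 4, rankOneMap (fun i => quarticPhase (z i)) fun i => quarticPhase (z i)) +
      ∑ i : n, rankOneMap (Pi.single i (1 : ℂ)) (Pi.single i (1 : ℂ)) := by
    refine linearMap_ext_single fun i j k l => ?_
    have hc : (Fintype.card (n → Fin 4) : ℂ) ≠ 0 := Nat.cast_ne_zero.mpr Fintype.card_ne_zero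
    have h2 : ∑ x : n, rankOneMap (Pi.single x (1 : ℂ)) (Pi.single x (1 : ℂ)) (single i j 1) k l =
        if i = j ∧ k = l ∧ i = k then 1 else 0 := by
      simp only [rankOneMap_single_apply]
      rw [Finset.sum_eq_single i]
      · by_cases hij : j = i <;> by_cases hik : k = i <;> by_cases hil : l = i <;>
          simp_all [Pi.single_apply, eq_comm]
      · intro b _ hb; simp [Pi.single_apply, hb.symm]
      · simp
    simp only [LinearMap.add_apply, LinearMap.smul_apply, LinearMap.sum_apply, Matrix.add_apply,
      Matrix.smul_apply, Matrix.sum_apply, h2, traceMap_single_apply, LinearMap.id_apply]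
    simp only [rankOneMap_single_apply, sum_four_quarticPhase, smul_eq_mul, mul_ite, mul_zero,
      Complex.ofReal_inv, Complex.ofReal_natCast, inv_mul_cancel₀ hc, single_apply]
    by_cases hij : i = j <;> by_cases hik : i = k <;> by_cases hkl : k = l <;>
      by_cases hjl : j = l <;> simp_all
  rw [h]
  refine Submodule.add_mem _ (measurePrepare_smul_mem ?_ (by positivity)) ?_ <;>
    exact measurePrepare_sum_mem _ fun _ _ => rankOneMap_mem _ _

/-- The isotropic map `X ↦ d tr(X) 1 - X` is measure-and-prepare. -/
theorem card_smul_traceMap_sub_id_mem (n : Type*) [Fintype n] [DecidableEq n] :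
    (Fintype.card n : ℂ) • traceMap n - LinearMap.id ∈ measurePrepare n n := by
  rcases isEmpty_or_nonempty n with hn | hn
  · convert (measurePrepare n n).zero_mem
    exact LinearMap.ext fun X => Subsingleton.elim _ _
  -- The Choi matrix of this map annihilates the maximally entangled vector, so every term must
  -- prepare a vector orthogonal to the measured one. Averaging the four phases leaves only the
  -- cross terms that produce `-X` off the diagonal; `1 / 8` accounts for four phases and for each
  -- pair being counted twice.
  have h : (Fintype.card n : ℂ) • traceMap n - LinearMap.id =
      (((1 / 8 : ℝ) : ℂ) • ∑ i : n, ∑ j ∈ Finset.univ.erase i, ∑ c : Fin 4,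
        rankOneMap (Pi.single i 1 + quarticPhase c • Pi.single j 1)
          (Pi.single i 1 - quarticPhase c • Pi.single j 1)) +
      (((Fintype.card n : ℝ) - 1 : ℝ) : ℂ) • ∑ i : n, ∑ j ∈ Finset.univ.erase i,
        rankOneMap (Pi.single i 1) (Pi.single j 1) := by
    refine linearMap_ext_single fun a b c e => ?_
    let p : n → n → ℂ := fun x y => if x = y then 1 else 0
    have hps : ∀ x y : n, (Pi.single x 1 : n → ℂ) y = p x y := by
      intro x y; simp [p, Pi.single_apply, eq_comm]
    have hst : ∀ x y : n, star (p x y) = p x y := by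
      intro x y; simp only [p]; split_ifs <;> simp
    have h4 : ∀ i j : n, ∑ k : Fin 4,
        rankOneMap (Pi.single i 1 + quarticPhase k • Pi.single j 1)
          (Pi.single i 1 - quarticPhase k • Pi.single j 1) (single a b 1) c e =
        4 * ((p i a * p i b + p j a * p j b) * (p i c * p i e + p j c * p j e) -
          (p i a * p i c) * (p j b * p j e) - (p i b * p i e) * (p j a * p j c)) := by
      intro i j
      have h3 : Complex.I ^ 3 = -Complex.I := by simp [pow_succ]
      have h4 : Complex.I ^ 4 = 1 := by simp
      simp only [rankOneMap_single_apply, Fin.sum_univ_four, Pi.add_apply, Pi.sub_apply,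
        Pi.smul_apply, smul_eq_mul, hps, star_add, star_sub, star_mul', hst]
      simp [quarticPhase, h3]
      ring_nf
      simp only [Complex.I_sq, h4]
      ring
    have hs : ∀ i : n, ∀ f : n → ℂ,
        ∑ j ∈ Finset.univ.erase i, f j = (∑ j, f j) - f i := fun i f => by
      rw [← Finset.add_sum_erase Finset.univ f (Finset.mem_univ i), add_sub_cancel_left]
    have hp : ∀ x y : n, ∑ i, p i x * p i y = p x y := fun x y => by simp [p, eq_comm]
    have hsum : ∀ f g f₁ f₂ g₁ g₂ : n → ℂ,
        ∑ i, ∑ j, 4 * ((f i + f j) * (g i + g j) - f₁ i * f₂ j - g₁ i * g₂ j) =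
        4 * (2 * Fintype.card n * ∑ i, f i * g i + 2 * ((∑ i, f i) * ∑ i, g i) -
          (∑ i, f₁ i) * (∑ i, f₂ i) - (∑ i, g₁ i) * (∑ i, g₂ i)) := by
      intro f g f₁ f₂ g₁ g₂
      simp only [← Finset.mul_sum, Finset.sum_sub_distrib, add_mul, mul_add,
        Finset.sum_add_distrib, Finset.sum_const, Finset.card_univ, nsmul_eq_mul,
        ← Finset.sum_mul]
      rw [show ∑ x, f x * ((Fintype.card n : ℂ) * g x) = Fintype.card n * ∑ x, f x * g x by
        rw [Finset.mul_sum]; exact Finset.sum_congr rfl fun _ _ => by ring]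
      ring
    have hpair : ∀ i j : n, rankOneMap (Pi.single i 1) (Pi.single j 1) (single a b 1) c e =
        (p i a * p i b) * (p j c * p j e) := fun i j => by
      simp only [rankOneMap_single_apply, hps, hst]
    have hone : traceMap n (single a b 1) c e = p a b * p c e := by
      rw [traceMap_single_apply]; simp only [p, ite_and, ite_mul, one_mul, zero_mul]
    have hid : (single a b (1 : ℂ)) c e = p a c * p b e := by
      rw [single_apply]; simp only [p, ite_and, ite_mul, one_mul, zero_mul]
    simp only [LinearMap.add_apply, LinearMap.sub_apply, LinearMap.smul_apply, LinearMap.sum_apply,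
      Matrix.add_apply, Matrix.sub_apply, Matrix.smul_apply, Matrix.sum_apply, h4, hpair,
      hone, LinearMap.id_apply, hid, hs, smul_eq_mul]
    rw [Finset.sum_sub_distrib, hsum, Finset.sum_sub_distrib, ← Finset.sum_mul_sum, ← Finset.mul_sum]
    simp only [hp]
    have hdiag : ∑ i, ((p i a * p i b + p i a * p i b) * (p i c * p i e + p i c * p i e) -
          (p i a * p i c) * (p i b * p i e) - (p i b * p i e) * (p i a * p i c)) =
        2 * ∑ i, (p i a * p i b) * (p i c * p i e) := by
      rw [Finset.mul_sum]
      exact Finset.sum_congr rfl fun i _ => by ring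
    rw [hdiag]
    push_cast
    ring
  have hd : (1 : ℝ) ≤ Fintype.card n := by exact_mod_cast Fintype.card_pos
  rw [h]
  refine Submodule.add_mem _ (measurePrepare_smul_mem ?_ (by norm_num))
    (measurePrepare_smul_mem ?_ (sub_nonneg.mpr hd))
  · exact measurePrepare_sum_mem _ fun _ _ => measurePrepare_sum_mem _ fun _ _ =>
      measurePrepare_sum_mem _ fun _ _ => rankOneMap_mem _ _
  · exact measurePrepare_sum_mem _ fun _ _ => measurePrepare_sum_mem _ fun _ _ =>
      rankOneMap_mem _ _

/-! ### Linear maps commuting with unitary conjugation -/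

theorem diagonal_mem_unitaryGroup {n : Type*} [Fintype n] [DecidableEq n] {z : n → ℂ}
    (hz : ∀ i, z i * star (z i) = 1) : diagonal z ∈ unitaryGroup n ℂ := by
  rw [mem_unitaryGroup_iff, star_eq_conjTranspose, diagonal_conjTranspose, diagonal_mul_diagonal]
  simp only [Pi.star_apply, hz]
  exact diagonal_one

/-- The real rotation with matrix `(3/5, 4/5; -4/5, 3/5)` in the plane of `o` and `o'`. -/
noncomputable def planeRotation {n : Type*} [DecidableEq n] (o o' : n) : Matrix n n ℂ :=
  1 + (-2 / 5 : ℂ) • (single o o 1 + single o' o' 1) +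
    (4 / 5 : ℂ) • (single o o' 1 - single o' o 1)

theorem planeRotation_mem_unitaryGroup {n : Type*} [Fintype n] [DecidableEq n] {o o' : n}
    (h : o ≠ o') : planeRotation o o' ∈ unitaryGroup n ℂ := by
  rw [mem_unitaryGroup_iff, star_eq_conjTranspose, planeRotation]
  simp only [conjTranspose_add, conjTranspose_sub, conjTranspose_smul, conjTranspose_one,
    conjTranspose_single, star_one, Matrix.mul_add, Matrix.add_mul, Matrix.mul_sub, Matrix.sub_mul,
    Matrix.smul_mul, Matrix.mul_smul, Matrix.mul_one, Matrix.one_mul, single_mul_single_same,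
    single_mul_single_of_ne _ _ _ _ h, single_mul_single_of_ne _ _ _ _ h.symm]
  have hs : star (-2 / 5 : ℂ) = -2 / 5 ∧ star (4 / 5 : ℂ) = 4 / 5 := by constructor <;> simp
  simp only [hs, mul_one]
  module

theorem permMatrix_mem_unitaryGroup {n : Type*} [Fintype n] [DecidableEq n]
    (σ : Equiv.Perm n) : σ.permMatrix ℂ ∈ unitaryGroup n ℂ := by
  rw [mem_unitaryGroup_iff, star_eq_conjTranspose, conjTranspose_permMatrix, ← permMatrix_mul,
    inv_mul_cancel, permMatrix_one]

/-- The factor is `3/5 * 4/5`. Any angle with nonzero sine and cosine would serve; this one keeps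
the arithmetic rational. -/
theorem planeRotation_conj_apply {n : Type*} [Fintype n] [DecidableEq n] {o o' : n} (h : o ≠ o')
    (M : Matrix n n ℂ) (h₁ : M o o' = 0) (h₂ : M o' o = 0) :
    (planeRotation o o' * M * (planeRotation o o')ᴴ) o o' = 12 / 25 * (M o' o' - M o o) := by
  have hr : ∀ a, planeRotation o o' o a =
      3 / 5 * (if a = o then 1 else 0) + 4 / 5 * (if a = o' then 1 else 0) := by
    intro a
    by_cases ha : o = a <;> by_cases hb : o' = a <;>
      simp_all [planeRotation, one_apply, eq_comm]; norm_num
  have hr' : ∀ a, star (planeRotation o o' o' a) =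
      3 / 5 * (if a = o' then 1 else 0) - 4 / 5 * (if a = o then 1 else 0) := by
    intro a
    by_cases ha : o = a <;> by_cases hb : o' = a <;>
      simp_all [planeRotation, single_apply, one_apply, eq_comm]; norm_num
  simp only [mul_apply, conjTranspose_apply, hr, hr', add_mul, mul_sub, Finset.sum_add_distrib,
    Finset.sum_sub_distrib]
  simp [h₁, h₂]
  ring

theorem exists_perm_apply_eq {n : Type*} [DecidableEq n] {o o' i k : n} (h : o ≠ o')
    (hik : i ≠ k) : ∃ σ : Equiv.Perm n, σ o = i ∧ σ o' = k := by
  have hx : Equiv.swap o i o' ≠ i := by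
    intro h'
    exact h ((Equiv.swap o i).injective (h'.trans (Equiv.swap_apply_left o i).symm)).symm
  exact ⟨(Equiv.swap o i).trans (Equiv.swap (Equiv.swap o i o') k),
    by simp [Equiv.swap_apply_of_ne_of_ne hx.symm hik], by simp⟩

/-- A linear map commuting with conjugation by every unitary is a combination of the completely
depolarizing map and the identity. -/
theorem eq_trace_add_id_of_commute_unitary {n : Type*} [Fintype n] [DecidableEq n] {o o' : n}
    (ho : o ≠ o') (L : Matrix n n ℂ →ₗ[ℂ] Matrix n n ℂ)
    (hL : ∀ U ∈ unitaryGroup n ℂ, ∀ X, L (U * X * Uᴴ) = U * L X * Uᴴ) (X : Matrix n n ℂ) :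
    L X = (L (single o o 1) o' o' * X.trace) • (1 : Matrix n n ℂ) +
      L (single o o' 1) o o' • X := by
  have hdiag : ∀ z : n → ℂ, (∀ i, z i * star (z i) = 1) → ∀ i j k l,
      z i * star (z j) * L (single i j 1) k l = z k * star (z l) * L (single i j 1) k l := by
    intro z hz i j k l
    have h := congrFun₂ (hL _ (diagonal_mem_unitaryGroup hz) (single i j 1)) k l
    have h2 : diagonal z * single i j 1 * (diagonal z)ᴴ = (z i * star (z j)) • single i j 1 := by
      rw [diagonal_conjTranspose]
      ext a b
      rw [mul_diagonal, diagonal_mul]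
      by_cases ha : i = a <;> by_cases hb : j = b <;> simp [ha, hb]
    rw [h2, map_smul, Matrix.smul_apply, smul_eq_mul, diagonal_conjTranspose, mul_diagonal,
      diagonal_mul] at h
    rw [h, Pi.star_apply]; ring
  have hperm : ∀ (σ : Equiv.Perm n) (i j k l : n),
      L (single (σ i) (σ j) 1) (σ k) (σ l) = L (single i j 1) k l := by
    intro σ i j k l
    have hconj : ∀ M : Matrix n n ℂ, σ.permMatrix ℂ * M * (σ.permMatrix ℂ)ᴴ = M.submatrix σ σ := by
      intro M
      rw [conjTranspose_permMatrix, Equiv.Perm.permMatrix, Equiv.Perm.permMatrix,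
        PEquiv.toMatrix_toPEquiv_mul, PEquiv.mul_toMatrix_toPEquiv]
      rfl
    have h := congrFun₂ (hL _ (permMatrix_mem_unitaryGroup σ) (single (σ i) (σ j) 1)) k l
    rw [hconj, hconj, submatrix_apply] at h
    have hsub : (single (σ i) (σ j) (1 : ℂ)).submatrix σ σ = single i j 1 :=
      Matrix.ext fun a b => by simp [single_apply]
    rw [← h, hsub]
  have hzero : ∀ i j k l, ¬ ((i = j ∧ k = l) ∨ (i = k ∧ j = l)) → L (single i j 1) k l = 0 := by
    intro i j k l h
    -- Conjugation by the diagonal unitary with `I` at position `m` scales input and output entries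
    -- differently, which forces the entry to vanish.
    have key : ∀ m : n, (if i = m then Complex.I else 1) * star (if j = m then Complex.I else 1) ≠
        (if k = m then Complex.I else 1) * star (if l = m then Complex.I else 1) →
        L (single i j 1) k l = 0 := by
      intro m hm
      have := hdiag (fun a => if a = m then Complex.I else 1)
        (fun a => by split_ifs <;> simp) i j k l
      rw [← sub_eq_zero, ← sub_mul] at this
      exact (mul_eq_zero.mp this).resolve_left (sub_ne_zero.mpr hm)
    have e1 : Complex.I ≠ 1 := fun h => by simpa using congrArg Complex.re h
    have e2 : -Complex.I ≠ 1 := fun h => by simpa using congrArg Complex.re h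
    have e3 : Complex.I ≠ -Complex.I := fun h => by
      have := congrArg Complex.im h
      norm_num at this
    by_cases hij : i = j
    · subst hij
      have hkl : k ≠ l := fun h' => h (Or.inl ⟨rfl, h'⟩)
      refine key k ?_
      by_cases hik : i = k <;> simp [hik, hkl.symm, e1.symm]
    · by_cases hik : i = k
      · subst hik
        have hjl : j ≠ l := fun h' => h (Or.inr ⟨rfl, h'⟩)
        refine key j ?_
        simp [hij, hjl.symm, e2]
      · refine key i ?_
        by_cases hil : i = l
        · subst hil
          simp [Ne.symm hij, Ne.symm hik, e3]
        · simp [Ne.symm hij, Ne.symm hik, Ne.symm hil, e1]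
  have hα : ∀ i k, i ≠ k → L (single i i 1) k k = L (single o o 1) o' o' := by
    intro i k hik
    obtain ⟨σ, rfl, rfl⟩ := exists_perm_apply_eq ho hik
    exact hperm σ _ _ _ _
  have hβ : ∀ i k, i ≠ k → L (single i k 1) i k = L (single o o' 1) o o' := by
    intro i k hik
    obtain ⟨σ, rfl, rfl⟩ := exists_perm_apply_eq ho hik
    exact hperm σ _ _ _ _
  -- Diagonal and permutation matrices leave three free constants; comparing the `(o, o')` entries
  -- under a genuine rotation gives the one remaining relation.
  have hγo : L (single o o 1) o o = L (single o o 1) o' o' + L (single o o' 1) o o' := by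
    have h := congrFun₂ (hL _ (planeRotation_mem_unitaryGroup ho) (single o o 1)) o o'
    rw [planeRotation_conj_apply ho _ (hzero _ _ _ _ (by simp [ho]))
      (hzero _ _ _ _ (by simp [ho, ho.symm]))] at h
    have h2 : planeRotation o o' * single o o 1 * (planeRotation o o')ᴴ =
        (9 / 25 : ℂ) • single o o 1 - (12 / 25 : ℂ) • (single o o' 1 + single o' o 1) +
          (16 / 25 : ℂ) • single o' o' 1 := by
      rw [planeRotation]
      simp only [conjTranspose_add, conjTranspose_sub, conjTranspose_smul, conjTranspose_one,
        conjTranspose_single, star_one, Matrix.mul_add, Matrix.add_mul, Matrix.mul_sub,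
        Matrix.sub_mul, Matrix.smul_mul, Matrix.mul_smul, Matrix.mul_one, Matrix.one_mul,
        single_mul_single_same, single_mul_single_of_ne _ _ _ _ ho,
        single_mul_single_of_ne _ _ _ _ ho.symm]
      have hs : star (-2 / 5 : ℂ) = -2 / 5 ∧ star (4 / 5 : ℂ) = 4 / 5 := by constructor <;> simp
      simp only [hs, mul_one, Matrix.zero_mul]
      module
    rw [h2] at h
    simp only [map_add, map_sub, map_smul, Matrix.add_apply, Matrix.sub_apply, Matrix.smul_apply,
      hzero o o o o' (by simp [ho]), hzero o' o o o' (by simp [ho, ho.symm]),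
      hzero o' o' o o' (by simp [ho, ho.symm]), smul_eq_mul] at h
    linear_combination (25 / 12) * h
  have hγ : ∀ i, L (single i i 1) i i = L (single o o 1) o' o' + L (single o o' 1) o o' := by
    intro i
    rw [← hγo, ← hperm (Equiv.swap o i) o o o o, Equiv.swap_apply_left]
  have hfinal : L = L (single o o 1) o' o' • traceMap n + L (single o o' 1) o o' • LinearMap.id := by
    refine linearMap_ext_single fun i j k l => ?_
    simp only [LinearMap.add_apply, LinearMap.smul_apply, Matrix.add_apply, Matrix.smul_apply,
      traceMap_single_apply, LinearMap.id_apply, single_apply, smul_eq_mul]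
    by_cases hij : i = j
    · subst hij
      by_cases hkl : k = l
      · subst hkl
        by_cases hik : i = k
        · subst hik; simp [hγ]
        · simp [hik, hα i k hik]
      · rw [hzero _ _ _ _ (by simp [hkl]; rintro rfl; exact hkl)]
        simp [hkl]
        rintro rfl; exact fun h => absurd h hkl
    · by_cases h : i = k ∧ j = l
      · obtain ⟨rfl, rfl⟩ := h
        simp [hij, hβ i j hij]
      · rw [hzero _ _ _ _ (by simp [hij, h])]
        simp [hij, h]
  conv_lhs => rw [hfinal]
  simp only [LinearMap.add_apply, LinearMap.smul_apply, traceMap_apply, smul_smul,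
    LinearMap.id_apply]

/-! ### Normal form of the symmetric maps -/

theorem tensorMap_Ad {m n : Type*} [Fintype m] [DecidableEq m] [Fintype n] [DecidableEq n]
    (U : Matrix m m ℂ) (V : Matrix n n ℂ) (X : Matrix (m × n) (m × n) ℂ) :
    tensorMap (Ad U) (Ad V) X = (U ⊗ₖ V) * X * (U ⊗ₖ V)ᴴ := by
  have : tensorMap (Ad U) (Ad V) = Ad (U ⊗ₖ V) := by
    refine linearMap_ext_kronecker fun A B => ?_
    rw [tensorMap_kronecker]
    change (U * A * Uᴴ) ⊗ₖ (V * B * Vᴴ) = (U ⊗ₖ V) * (A ⊗ₖ B) * (U ⊗ₖ V)ᴴ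
    rw [conjTranspose_kronecker, ← mul_kronecker_mul, ← mul_kronecker_mul]
  rw [this]; rfl

/-- The normal form of the maps with the unitary symmetry. -/
def IsSymmetricForm {n : Type*} [Fintype n] [DecidableEq n]
    (T : Matrix (n × n) (n × n) ℂ →ₗ[ℂ] Matrix (n × n) (n × n) ℂ) (a b c e : ℂ) : Prop :=
  ∀ X Y : Matrix n n ℂ, T (X ⊗ₖ Y) =
    (a * X.trace * Y.trace) • (1 : Matrix n n ℂ) ⊗ₖ (1 : Matrix n n ℂ) +
    (b * X.trace) • (1 : Matrix n n ℂ) ⊗ₖ Y +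
    (c * Y.trace) • Xᵀ ⊗ₖ (1 : Matrix n n ℂ) + e • Xᵀ ⊗ₖ Y

/-- Transposing the first input turns the symmetry into ordinary covariance under `U ⊗ V`, since `Ad
Uᵀ` undoes the transposed conjugation by `U`. -/
theorem HasUnitarySymmetry.apply_kronecker {d : ℕ}
    {T : Matrix (Fin d × Fin d) (Fin d × Fin d) ℂ →ₗ[ℂ] Matrix (Fin d × Fin d) (Fin d × Fin d) ℂ}
    (hT : HasUnitarySymmetry T) {U V : Matrix (Fin d) (Fin d) ℂ} (hU : U ∈ unitaryGroup (Fin d) ℂ)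
    (hV : V ∈ unitaryGroup (Fin d) ℂ) (X Y : Matrix (Fin d) (Fin d) ℂ) :
    T ((U * X * Uᴴ)ᵀ ⊗ₖ (V * Y * Vᴴ)) = (U ⊗ₖ V) * T (Xᵀ ⊗ₖ Y) * (U ⊗ₖ V)ᴴ := by
  have h := LinearMap.congr_fun (hT U hU V hV) ((U * X * Uᴴ)ᵀ ⊗ₖ (V * Y * Vᴴ))
  rw [← h]
  simp only [LinearMap.comp_apply]
  rw [tensorMap_Ad, tensorMap_kronecker]
  have hU' : Uᴴ * U = 1 := mem_unitaryGroup_iff'.mp hU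
  have hV' : Vᴴ * V = 1 := mem_unitaryGroup_iff'.mp hV
  have e1 : Ad Uᵀ (U * X * Uᴴ)ᵀ = Xᵀ := by
    change Uᵀ * (U * X * Uᴴ)ᵀ * Uᵀᴴ = Xᵀ
    have : Uᵀᴴ = Uᴴᵀ := rfl
    rw [this, ← transpose_mul, ← transpose_mul, Matrix.mul_assoc, Matrix.mul_assoc, hU',
      Matrix.mul_one, ← Matrix.mul_assoc, hU', Matrix.one_mul]
  have e2 : Ad Vᴴ (V * Y * Vᴴ) = Y := by
    change Vᴴ * (V * Y * Vᴴ) * Vᴴᴴ = Y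
    rw [conjTranspose_conjTranspose, Matrix.mul_assoc, Matrix.mul_assoc, hV', Matrix.mul_one,
      ← Matrix.mul_assoc, hV', Matrix.one_mul]
  rw [e1, e2]

/-- The second-factor block of `T (Xᵀ ⊗ Y)`, as a linear map in `Y`. -/
def sndBlock {n : Type*} [Fintype n] [DecidableEq n]
    (T : Matrix (n × n) (n × n) ℂ →ₗ[ℂ] Matrix (n × n) (n × n) ℂ) (X : Matrix n n ℂ) (k l : n) :
    Matrix n n ℂ →ₗ[ℂ] Matrix n n ℂ :=
  block k l ∘ₗ T ∘ₗ (kroneckerBilinear (R := ℂ) (α := ℂ) :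
    Matrix n n ℂ →ₗ[ℂ] Matrix n n ℂ →ₗ[ℂ] Matrix (n × n) (n × n) ℂ) Xᵀ

/-- The first-factor block of `T (Xᵀ ⊗ Y)`, as a linear map in `X`. -/
def fstBlock {n : Type*} [Fintype n] [DecidableEq n]
    (T : Matrix (n × n) (n × n) ℂ →ₗ[ℂ] Matrix (n × n) (n × n) ℂ) (Y : Matrix n n ℂ) (r s : n) :
    Matrix n n ℂ →ₗ[ℂ] Matrix n n ℂ where
  toFun X := of fun k l => T (Xᵀ ⊗ₖ Y) (k, r) (l, s)
  map_add' X X' := by ext; simp [add_kronecker]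
  map_smul' c X := by ext; simp [smul_kronecker]

theorem fstBlock_apply {n : Type*} [Fintype n] [DecidableEq n]
    (T : Matrix (n × n) (n × n) ℂ →ₗ[ℂ] Matrix (n × n) (n × n) ℂ) (X Y : Matrix n n ℂ)
    (r s k l : n) : fstBlock T Y r s X k l = T (Xᵀ ⊗ₖ Y) (k, r) (l, s) := rfl

theorem fst_conj_apply {n : Type*} [Fintype n] [DecidableEq n] (U : Matrix n n ℂ)
    (M : Matrix (n × n) (n × n) ℂ) (r s : n) :
    (of fun k l => ((U ⊗ₖ (1 : Matrix n n ℂ)) * M * (U ⊗ₖ (1 : Matrix n n ℂ))ᴴ) (k, r) (l, s)) =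
      U * (of fun k l => M (k, r) (l, s)) * Uᴴ := by
  ext k l
  simp [mul_apply, Fintype.sum_prod_type, one_apply, conjTranspose_kronecker, apply_ite]

theorem snd_conj_apply {n : Type*} [Fintype n] [DecidableEq n] (V : Matrix n n ℂ)
    (M : Matrix (n × n) (n × n) ℂ) (k l : n) :
    block k l (((1 : Matrix n n ℂ) ⊗ₖ V) * M * ((1 : Matrix n n ℂ) ⊗ₖ V)ᴴ) =
      V * block k l M * Vᴴ := by
  ext r s
  simp [mul_apply, Fintype.sum_prod_type, one_apply, conjTranspose_kronecker, apply_ite,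
    block_apply]

/-- The classification of covariant maps is used twice: with `V = 1`, in `X` for each block; then
with `U = 1`, in `Y`, on the coefficients so obtained, which are themselves entries of covariant
maps. -/
theorem HasUnitarySymmetry.exists_isSymmetricForm {d : ℕ} (hd : 2 ≤ d)
    {T : Matrix (Fin d × Fin d) (Fin d × Fin d) ℂ →ₗ[ℂ] Matrix (Fin d × Fin d) (Fin d × Fin d) ℂ}
    (hT : HasUnitarySymmetry T) : ∃ a b c e, IsSymmetricForm T a b c e := by
  obtain ⟨o, o', ho⟩ : ∃ o o' : Fin d, o ≠ o' :=
    ⟨⟨0, by omega⟩, ⟨1, by omega⟩, by simp⟩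
  have hfst : ∀ X Y r s, fstBlock T Y r s X =
      (sndBlock T (single o o 1) o' o' Y r s * X.trace) • (1 : Matrix (Fin d) (Fin d) ℂ) +
        sndBlock T (single o o' 1) o o' Y r s • X := by
    intro X Y r s
    refine eq_trace_add_id_of_commute_unitary ho (fstBlock T Y r s) (fun U hU X => ?_) X
    have h := hT.apply_kronecker hU (one_mem _) X Y
    rw [conjTranspose_one, Matrix.one_mul, Matrix.mul_one] at h
    change (of fun k l => T ((U * X * Uᴴ)ᵀ ⊗ₖ Y) (k, r) (l, s)) = _
    rw [h, fst_conj_apply]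
    rfl
  have hsnd : ∀ X k l Y, sndBlock T X k l Y =
      (sndBlock T X k l (single o o 1) o' o' * Y.trace) • (1 : Matrix (Fin d) (Fin d) ℂ) +
        sndBlock T X k l (single o o' 1) o o' • Y := by
    intro X k l Y
    refine eq_trace_add_id_of_commute_unitary ho (sndBlock T X k l) (fun V hV Y => ?_) Y
    have h := hT.apply_kronecker (one_mem _) hV X Y
    rw [conjTranspose_one, Matrix.one_mul, Matrix.mul_one] at h
    change block k l (T (Xᵀ ⊗ₖ (V * Y * Vᴴ))) = _
    rw [h, snd_conj_apply]
    rfl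
  refine ⟨sndBlock T (single o o 1) o' o' (single o o 1) o' o',
    sndBlock T (single o o 1) o' o' (single o o' 1) o o',
    sndBlock T (single o o' 1) o o' (single o o 1) o' o',
    sndBlock T (single o o' 1) o o' (single o o' 1) o o', fun X Y => ?_⟩
  ext ⟨k, r⟩ ⟨l, s⟩
  have h := congrFun₂ (hfst Xᵀ Y r s) k l
  rw [fstBlock_apply, transpose_transpose] at h
  rw [h, hsnd (single o o 1), hsnd (single o o' 1)]
  simp only [Matrix.add_apply, Matrix.smul_apply, kroneckerMap_apply, smul_eq_mul,
    trace_transpose]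
  ring

/-! ### Positivity conditions on the coefficients -/

theorem IsCompletelyPositive.sum_nonneg {m p ι : Type*} [Finite m] [Fintype p] [Fintype ι]
    {T : Matrix m m ℂ →ₗ[ℂ] Matrix p p ℂ} (hT : IsCompletelyPositive T)
    (x : ι → m → ℂ) (y : ι → p → ℂ) :
    0 ≤ ∑ i, ∑ j, star (y i) ⬝ᵥ T (vecMulVec (x i) (star (x j))) *ᵥ y j := by
  have hfin : ∀ (n : ℕ) (x : Fin n → m → ℂ) (y : Fin n → p → ℂ),
      0 ≤ ∑ i, ∑ j, star (y i) ⬝ᵥ T (vecMulVec (x i) (star (x j))) *ᵥ y j := by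
    intro n x y
    let ξ : Fin n × m → ℂ := fun a => x a.1 a.2
    have h := (hT n _ (posSemidef_vecMulVec_self_star ξ)).dotProduct_mulVec_nonneg
      (fun a => y a.1 a.2)
    convert h using 1
    have hb : ∀ i j, block i j (vecMulVec ξ (star ξ)) = vecMulVec (x i) (star (x j)) :=
      fun i j => rfl
    simp only [dotProduct, mulVec, Fintype.sum_prod_type, tensorMap_id_apply, hb, Finset.mul_sum,
      Pi.star_apply]
    exact Finset.sum_congr rfl fun i _ => Finset.sum_comm
  let e := Fintype.equivFin ι
  have h := hfin _ (x ∘ e.symm) (y ∘ e.symm)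
  rw [← e.sum_comp] at h
  convert h using 2 with i
  rw [← e.sum_comp]
  simp

/-- This is the quadratic form of the Choi matrix at `∑ i, σ i • (e_{u i} ⊗ e_{w i})`, so test
vectors can be given by lists of basis indices. -/
theorem IsCompletelyPositive.sum_single_nonneg {m p ι : Type*} [Fintype m] [DecidableEq m]
    [Fintype p] [DecidableEq p] [Fintype ι]
    {T : Matrix m m ℂ →ₗ[ℂ] Matrix p p ℂ} (hT : IsCompletelyPositive T)
    (u : ι → m) (w : ι → p) (σ : ι → ℂ) :
    0 ≤ ∑ i, ∑ j, star (σ i) * σ j * T (single (u i) (u j) 1) (w i) (w j) := by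
  have h := hT.sum_nonneg (fun i => Pi.single (u i) 1) (fun i => Pi.single (w i) (σ i))
  convert h using 4 with i _ j _
  have : vecMulVec (Pi.single (u i) (1 : ℂ)) (star (Pi.single (u j) (1 : ℂ))) =
      single (u i) (u j) 1 := by
    ext a b
    by_cases ha : u i = a <;> by_cases hb : u j = b <;>
      simp_all [vecMulVec_apply, eq_comm]
  rw [this, ← Pi.single_star, single_dotProduct, mulVec_single]
  simp
  ring

theorem IsSymmetricForm.single_apply {n : Type*} [Fintype n] [DecidableEq n]
    {T : Matrix (n × n) (n × n) ℂ →ₗ[ℂ] Matrix (n × n) (n × n) ℂ} {a b c e : ℂ}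
    (hT : IsSymmetricForm T a b c e) (i j k l r s t u : n) :
    T (single (i, k) (j, l) 1) (r, t) (s, u) =
      a * (if i = j ∧ k = l ∧ r = s ∧ t = u then 1 else 0) +
      b * (if i = j ∧ r = s ∧ k = t ∧ l = u then 1 else 0) +
      c * (if k = l ∧ t = u ∧ j = r ∧ i = s then 1 else 0) +
      e * (if j = r ∧ i = s ∧ k = t ∧ l = u then 1 else 0) := by
  have h := congrFun₂ (hT (single i j 1) (single k l 1)) (r, t) (s, u)
  rw [single_kronecker_single, mul_one] at h
  have ht : ∀ x y : n, (single x y (1 : ℂ)).trace = if x = y then 1 else 0 := by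
    intro x y
    by_cases hxy : x = y <;> simp [hxy, trace_single_eq_of_ne]
  rw [h]
  simp only [Matrix.add_apply, Matrix.smul_apply, kroneckerMap_apply, smul_eq_mul, ht, one_apply,
    transpose_single, Matrix.single_apply, ite_and]
  simp only [mul_ite, mul_zero, mul_one]
  congr 1
  · congr 1
    · congr 1
      · split_ifs <;> rfl
      · split_ifs <;> rfl
    · split_ifs <;> rfl
  · split_ifs <;> rfl

/-- The positivity conditions on the coefficients of the normal form that express that its Choi
matrix and the partial transpose of its Choi matrix are positive. -/
structure IsPPTCoeff (d a b c e : ℝ) : Prop where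
  add_c : 0 ≤ a + c
  sub_c : 0 ≤ a - c
  add_c_add : 0 ≤ a + c + d * (b + e)
  sub_c_add : 0 ≤ a - c + d * (b - e)
  add_b : 0 ≤ a + b
  sub_b : 0 ≤ a - b
  add_b_add : 0 ≤ a + b + d * (c + e)
  sub_b_add : 0 ≤ a - b + d * (c - e)

/-- The test vectors are eigenvectors of the Choi matrix: symmetric or antisymmetric for the flip on
the pair `f, f'`, and orthogonal or parallel to the maximally entangled vector on `g, g'`.
Unnormalized vectors cause the factors `2` and `Fintype.card n`. -/
theorem choi_conditions {n : Type} [Fintype n] [DecidableEq n] {o o' : n} (ho : o ≠ o')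
    {a b c e : ℂ}
    (h : ∀ (ι : Type) [Fintype ι] (f f' g g' : ι → n) (σ : ι → ℂ),
      0 ≤ ∑ x, ∑ y, star (σ x) * σ y *
        (a * (if f x = f y ∧ g x = g y ∧ f' x = f' y ∧ g' x = g' y then 1 else 0) +
        b * (if f x = f y ∧ f' x = f' y ∧ g x = g' x ∧ g y = g' y then 1 else 0) +
        c * (if g x = g y ∧ g' x = g' y ∧ f y = f' x ∧ f x = f' y then 1 else 0) +
        e * (if f y = f' x ∧ f x = f' y ∧ g x = g' x ∧ g y = g' y then 1 else 0))) :
    0 ≤ a + c ∧ 0 ≤ 2 * (a - c) ∧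
      0 ≤ (Fintype.card n : ℂ) * (a + c + Fintype.card n * (b + e)) ∧
      0 ≤ (Fintype.card n : ℂ) * (2 * (a - c + Fintype.card n * (b - e))) := by
  refine ⟨?_, ?_, ?_, ?_⟩
  · have := h Unit (fun _ => o) (fun _ => o) (fun _ => o) (fun _ => o') (fun _ => 1)
    simpa [ho] using this
  · have := h (Fin 2) ![o, o'] ![o', o] (fun _ => o) (fun _ => o') ![1, -1]
    simp [ho, ho.symm, Fin.sum_univ_two] at this
    convert this using 1
    ring
  · have := h n (fun _ => o) (fun _ => o) id id (fun _ => 1)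
    simp [Finset.sum_add_distrib] at this
    convert this using 1
    ring
  · have := h (Fin 2 × n) (fun x => ![o, o'] x.1) (fun x => ![o', o] x.1) (fun x => x.2)
      (fun x => x.2) (fun x => ![1, -1] x.1)
    simp [ho, ho.symm, Fin.sum_univ_two, Fintype.sum_prod_type, Finset.sum_add_distrib] at this
    convert this using 1
    ring

theorem exists_isPPTCoeff {d : ℕ} (hd : 2 ≤ d)
    {T : Matrix (Fin d × Fin d) (Fin d × Fin d) ℂ →ₗ[ℂ] Matrix (Fin d × Fin d) (Fin d × Fin d) ℂ}
    (hcp : IsCompletelyPositive T) (hco : IsCompletelyCopositive T) (hT : HasUnitarySymmetry T) :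
    ∃ a b c e : ℝ, IsSymmetricForm T a b c e ∧ IsPPTCoeff d a b c e := by
  obtain ⟨a, b, c, e, h⟩ := hT.exists_isSymmetricForm hd
  have ho : (⟨0, by omega⟩ : Fin d) ≠ ⟨1, by omega⟩ := by simp
  obtain ⟨h1, h2, h3, h4⟩ := choi_conditions ho (a := a) (b := b) (c := c) (e := e)
    fun ι _ f f' g g' σ => by
      have := hcp.sum_single_nonneg (fun i => (f i, g i)) (fun i => (f' i, g' i)) σ
      simpa only [h.single_apply] using this
  -- Composing with the transposition moves the flip to the second factor, so the factors, and with
  -- them `b` and `c`, trade places.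
  obtain ⟨k1, k2, k3, k4⟩ := choi_conditions ho (a := a) (b := c) (c := b) (e := e)
    fun ι _ g g' f f' σ => by
      have := IsCompletelyPositive.sum_single_nonneg hco (fun i => (f i, g i))
        (fun i => (f' i, g' i)) σ
      have ent : ∀ X u v, ((transposeLinearEquiv _ _ ℂ ℂ).toLinearMap ∘ₗ T) X u v = T X v u :=
        fun _ _ _ => rfl
      simp only [ent, h.single_apply] at this
      refine this.trans_eq (Finset.sum_congr rfl fun x _ => Finset.sum_congr rfl fun y _ => ?_)
      rw [add_right_comm (a * _)]
      congr 1
      congr 1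
      · congr 1
        · congr 1 <;> congr 2 <;> simp only [eq_iff_iff] <;> tauto
        · congr 2; simp only [eq_iff_iff]; tauto
      · congr 2; simp only [eq_iff_iff]; tauto
  have hd' : (0 : ℝ) < d := by positivity
  have hre : ∀ (r : ℝ) (z : ℂ), 0 < r → 0 ≤ (r : ℂ) * z → 0 ≤ z.re ∧ z.im = 0 := by
    intro r z hr hz
    obtain ⟨hz₁, hz₂⟩ := Complex.nonneg_iff.mp hz
    rw [Complex.re_ofReal_mul] at hz₁
    rw [Complex.im_ofReal_mul] at hz₂
    exact ⟨nonneg_of_mul_nonneg_right hz₁ hr, (mul_eq_zero.mp hz₂.symm).resolve_left hr.ne'⟩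
  rw [Fintype.card_fin] at h3 h4 k3 k4
  have H1 := hre 1 _ one_pos (by simpa using h1)
  have H2 := hre 2 _ two_pos (by simpa using h2)
  have H3 := hre d _ hd' (by simpa using h3)
  have H4 := hre (d * 2) (a - c + ((d : ℝ) : ℂ) * (b - e)) (by positivity)
    (by push_cast; rw [mul_assoc]; exact h4)
  have K1 := hre 1 _ one_pos (by simpa using k1)
  have K2 := hre 2 _ two_pos (by simpa using k2)
  have K3 := hre d _ hd' (by simpa using k3)
  have K4 := hre (d * 2) (a - b + ((d : ℝ) : ℂ) * (c - e)) (by positivity)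
    (by push_cast; rw [mul_assoc]; exact k4)
  rw [← Complex.ofReal_natCast] at H3 K3
  simp only [Complex.add_re, Complex.add_im, Complex.sub_re, Complex.sub_im, Complex.re_ofReal_mul,
    Complex.im_ofReal_mul] at H1 H2 H3 H4 K1 K2 K3 K4
  have ha : a.im = 0 := by linarith
  have hb : b.im = 0 := by linarith
  have hc : c.im = 0 := by linarith
  have he : e.im = 0 := by
    have : (d : ℝ) * e.im = 0 := by nlinarith
    exact (mul_eq_zero.mp this).resolve_left hd'.ne'
  have hof : ∀ z : ℂ, z.im = 0 → ((z.re : ℝ) : ℂ) = z := fun z hz =>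
    Complex.ext (by simp) (by simp [hz])
  refine ⟨a.re, b.re, c.re, e.re, ?_, ⟨H1.1, H2.1, H3.1, H4.1, K1.1, K2.1, K3.1, K4.1⟩⟩
  rwa [hof a ha, hof b hb, hof c hc, hof e he]

/-! ### Nonnegativity of the coefficients of the composition -/

/-- The pairings of the coefficients of two maps in normal form that yield the coefficients of
their composition in the basis of products of the two extremal isotropic maps are nonnegative. -/
theorem pairing_add_add_nonneg {d a b c e A B C E : ℝ} (hd : 2 ≤ d) (h : IsPPTCoeff d a b c e)
    (k : IsPPTCoeff d A B C E) :
    0 ≤ d * (d * (a * A) + (a * B + b * A) + d * (b * B)) +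
      ((d * (a * C) + (a * E + b * C) + d * (b * E)) +
        (d * (c * A) + (c * B + e * A) + d * (e * B))) +
      d * (d * (c * C) + (c * E + e * C) + d * (e * E)) := by
  obtain ⟨h1, h2, h3, h4, -, -, -, -⟩ := h
  obtain ⟨k1, k2, k3, k4, -, -, -, -⟩ := k
  have e1 := mul_nonneg h1 k1
  have e2 := mul_nonneg h2 k2
  have e3 := mul_nonneg h3 k3
  have e4 := mul_nonneg h4 k4
  have hd2 : 0 ≤ d ^ 2 - 1 := by nlinarith
  refine nonneg_of_mul_nonneg_right (a := 2 * d) ?_ (by linarith)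
  -- `2 * d` times the pairing is a nonnegative combination of products of matching Choi
  -- eigenvalues.
  have : 0 ≤ (d + 1) * ((a + c + d * (b + e)) * (A + C + d * (B + E)) +
      (d ^ 2 - 1) * ((a + c) * (A + C))) + (d - 1) * ((a - c + d * (b - e)) *
      (A - C + d * (B - E)) + (d ^ 2 - 1) * ((a - c) * (A - C))) :=
    add_nonneg (mul_nonneg (by linarith) (add_nonneg e3 (mul_nonneg hd2 e1)))
      (mul_nonneg (by linarith) (add_nonneg e4 (mul_nonneg hd2 e2)))
  refine this.trans_eq ?_
  ring

/-- The hypotheses force `x, X ≥ 0`, while `x'` and `X'` may have either sign. If these signs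
differ, `x' * X'` helps; if both are nonnegative, each summand is nonnegative separately because `d
+ 1 ≤ d ^ 2`. -/
theorem weighted_pairing_nonneg {d u u' x x' U U' X X' : ℝ} (hd : 2 ≤ d) (hu : 0 ≤ u)
    (hu' : 0 ≤ u') (hU : 0 ≤ U) (hU' : 0 ≤ U') (hx : d * x ≤ (d + 1) * u)
    (hx' : d * x' ≤ (d + 1) * u') (hX : d * X ≤ (d + 1) * U) (hX' : d * X' ≤ (d + 1) * U')
    (h₁ : 0 ≤ x + x') (h₂ : (d - 1) * x' ≤ (d + 1) * x)
    (k₁ : 0 ≤ X + X') (k₂ : (d - 1) * X' ≤ (d + 1) * X) :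
    0 ≤ (d + 1) * ((d + 1) * (u * U) - x * X) + (d - 1) * ((d + 1) * (u' * U') - x' * X') := by
  have hx0 : 0 ≤ x := by nlinarith
  have hX0 : 0 ≤ X := by nlinarith
  have hd2 : 0 < d ^ 2 := by positivity
  have huU := mul_nonneg hu hU
  have huU' := mul_nonneg hu' hU'
  have hprod : d ^ 2 * (x * X) ≤ (d + 1) ^ 2 * (u * U) := by
    have := mul_le_mul hx hX (by positivity) (by positivity)
    linarith
  have hdd : d + 1 ≤ d ^ 2 := by nlinarith
  have bound : ∀ p q : ℝ, 0 ≤ p → d ^ 2 * q ≤ (d + 1) ^ 2 * p → 0 ≤ (d + 1) * p - q := by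
    intro p q hp hq
    refine nonneg_of_mul_nonneg_right (a := d ^ 2) ?_ hd2
    have : 0 ≤ (d + 1) * ((d ^ 2 - (d + 1)) * p) :=
      mul_nonneg (by linarith) (mul_nonneg (by linarith) hp)
    linarith
  have hfirst := bound _ _ huU hprod
  rcases le_total 0 x' with hs | hs <;> rcases le_total 0 X' with hS | hS
  · have hprod' : d ^ 2 * (x' * X') ≤ (d + 1) ^ 2 * (u' * U') := by
      have := mul_le_mul hx' hX' (by positivity) (by positivity)
      linarith
    exact add_nonneg (mul_nonneg (by linarith) hfirst)
      (mul_nonneg (by linarith) (bound _ _ huU' hprod'))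
  · refine add_nonneg (mul_nonneg (by linarith) hfirst) (mul_nonneg (by linarith) ?_)
    have := mul_nonneg (by linarith : (0 : ℝ) ≤ d + 1) huU'
    have := mul_nonpos_of_nonneg_of_nonpos hs hS
    linarith
  · refine add_nonneg (mul_nonneg (by linarith) hfirst) (mul_nonneg (by linarith) ?_)
    have := mul_nonneg (by linarith : (0 : ℝ) ≤ d + 1) huU'
    have := mul_nonpos_of_nonpos_of_nonneg hs hS
    linarith
  -- With both negative, `|x'| ≤ x` and `|X'| ≤ X` bound the total loss by `2 * d * (x * X)`, which
  -- the first term alone absorbs when `d ≥ 2`.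
  · have hneg : x' * X' ≤ x * X := by
      have := mul_le_mul (by linarith : -x' ≤ x) (by linarith : -X' ≤ X) (by linarith) hx0
      linarith
    have h1 : 0 ≤ (d + 1) ^ 2 * (u * U) - 2 * d * (x * X) := by
      refine nonneg_of_mul_nonneg_right (a := d) ?_ (by linarith)
      have : 0 ≤ (d - 2) * ((d + 1) ^ 2 * (u * U)) :=
        mul_nonneg (by linarith) (mul_nonneg (by positivity) huU)
      linarith
    have h2 := mul_le_mul_of_nonneg_left hneg (by linarith : (0 : ℝ) ≤ d - 1)
    have h3 : 0 ≤ (d - 1) * ((d + 1) * (u' * U')) :=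
      mul_nonneg (by linarith) (mul_nonneg (by linarith) huU')
    linarith

/-- Twice this pairing is the weighted one in the variables below. The complete positivity
conditions bound `x` and `x'` from above; `sub_b` and `sub_b_add` are the two relations between
them. -/
theorem pairing_add_sub_nonneg {d a b c e A B C E : ℝ} (hd : 2 ≤ d) (h : IsPPTCoeff d a b c e)
    (k : IsPPTCoeff d A B C E) :
    0 ≤ d * (d * (a * A) + (a * B + b * A) - b * B) +
      ((d * (a * C) + (a * E + b * C) - b * E) + (d * (c * A) + (c * B + e * A) - e * B)) +
      d * (d * (c * C) + (c * E + e * C) - e * E) := by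
  obtain ⟨h1, h2, h3, h4, -, h6, -, h8⟩ := h
  obtain ⟨k1, k2, k3, k4, -, k6, -, k8⟩ := k
  have := weighted_pairing_nonneg hd h1 h2 k1 k2 (x := a + c - (b + e)) (x' := a - c - (b - e))
    (X := A + C - (B + E)) (X' := A - C - (B - E)) (by linarith) (by linarith) (by linarith)
    (by linarith) (by linarith) (by linarith) (by linarith) (by linarith)
  linarith

/-- Complete positivity of one map is played against copositivity of the other: `4 * d ^ 2` times
the pairing is a combination of nine products of such quantities, with weights nonnegative for `d ≥
2`. -/
theorem pairing_sub_sub_nonneg {d a b c e A B C E : ℝ} (hd : 2 ≤ d) (h : IsPPTCoeff d a b c e)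
    (k : IsPPTCoeff d A B C E) :
    0 ≤ d * (d * (a * A) + (a * B + b * A) - b * B) +
      ((d * (a * C) + (a * E + b * C) - b * E) + (d * (c * A) + (c * B + e * A) - e * B)) -
      (d * (c * C) + (c * E + e * C) - e * E) := by
  obtain ⟨h1, h2, h3, h4, -, -, -, -⟩ := h
  obtain ⟨-, -, -, -, k1, k2, k3, k4⟩ := k
  have hp : 0 ≤ d * (d + 1) := by positivity
  have hq : 0 ≤ (d - 2) * (d + 1) := mul_nonneg (by linarith) (by linarith)
  refine nonneg_of_mul_nonneg_right (a := 4 * d ^ 2) ?_ (by positivity)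
  generalize hP : d * (d + 1) = P at hp
  generalize hQ : (d - 2) * (d + 1) = Q at hq
  have : 0 ≤
      P * (P * ((a + c) * (A + B)) + Q * ((a + c) * (A - B)) +
        2 * ((a + c + d * (b + e)) * (A - B))) +
      Q * (P * ((a - c) * (A + B)) + Q * ((a - c) * (A - B)) +
        2 * ((a - c + d * (b - e)) * (A - B))) +
      2 * (P * ((a - c) * (A + B + d * (C + E))) + Q * ((a - c) * (A - B + d * (C - E))) +
        2 * ((a - c + d * (b - e)) * (A - B + d * (C - E)))) := by
    have := mul_nonneg h1 k1
    have := mul_nonneg h1 k2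
    have := mul_nonneg h3 k2
    have := mul_nonneg h2 k1
    have := mul_nonneg h2 k2
    have := mul_nonneg h4 k2
    have := mul_nonneg h2 k3
    have := mul_nonneg h2 k4
    have := mul_nonneg h4 k4
    positivity
  refine this.trans_eq ?_
  rw [← hP, ← hQ]
  ring

theorem IsPPTCoeff.swap {d a b c e : ℝ} (h : IsPPTCoeff d a b c e) : IsPPTCoeff d a c b e :=
  ⟨h.5, h.6, h.7, h.8, h.1, h.2, h.3, h.4⟩

/-! ### The composition is measure-and-prepare -/

/-- The composition of two maps in normal form. -/
theorem IsSymmetricForm.comp_apply {n : Type*} [Fintype n] [DecidableEq n]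
    {T₁ T₂ : Matrix (n × n) (n × n) ℂ →ₗ[ℂ] Matrix (n × n) (n × n) ℂ} {a b c e A B C E : ℂ}
    (h₁ : IsSymmetricForm T₁ a b c e) (h₂ : IsSymmetricForm T₂ A B C E) (X Y : Matrix n n ℂ) :
    T₂ (T₁ (X ⊗ₖ Y)) =
      ((Fintype.card n ^ 2 * (a * A) + Fintype.card n * (a * B + b * A + a * C + c * A) +
        (a * E + e * A + b * C + c * B)) * X.trace * Y.trace) •
          (1 : Matrix n n ℂ) ⊗ₖ (1 : Matrix n n ℂ) +
      ((Fintype.card n * (b * B) + b * E + e * B) * X.trace) • (1 : Matrix n n ℂ) ⊗ₖ Y +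
      ((Fintype.card n * (c * C) + c * E + e * C) * Y.trace) • X ⊗ₖ (1 : Matrix n n ℂ) +
      (e * E) • X ⊗ₖ Y := by
  rw [h₁ X Y]
  simp only [map_add, map_smul, h₂ _ _, trace_one, trace_transpose, transpose_transpose,
    transpose_one]
  module

theorem comp_mem_measurePrepare {d : ℕ} (hd : 2 ≤ d)
    {T₁ T₂ : Matrix (Fin d × Fin d) (Fin d × Fin d) ℂ →ₗ[ℂ] Matrix (Fin d × Fin d) (Fin d × Fin d) ℂ}
    {a b c e A B C E : ℝ} (h₁ : IsSymmetricForm T₁ a b c e) (h₂ : IsSymmetricForm T₂ A B C E)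
    (p₁ : IsPPTCoeff d a b c e) (p₂ : IsPPTCoeff d A B C E) :
    T₂ ∘ₗ T₁ ∈ measurePrepare (Fin d × Fin d) (Fin d × Fin d) := by
  have hd2 : (2 : ℝ) ≤ d := by exact_mod_cast hd
  have hP := traceMap_add_id_mem (Fin d)
  have hM := card_smul_traceMap_sub_id_mem (Fin d)
  rw [Fintype.card_fin] at hM
  have q₁ := pairing_add_add_nonneg hd2 p₁ p₂
  have q₂ := pairing_add_sub_nonneg hd2 p₁ p₂
  have q₃ := pairing_add_sub_nonneg hd2 p₁.swap p₂.swap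
  have q₄ := pairing_sub_sub_nonneg hd2 p₁ p₂
  have hw : (0 : ℝ) ≤ ((d + 1 : ℝ) ^ 2)⁻¹ := by positivity
  -- From `(d + 1) tr(·) 1 = P + M` and `(d + 1) id = d P - M`, expanding both factors gives the
  -- pairings divided by `(d + 1) ^ 2`. Exchanging `b` and `c` in both maps yields the coefficient
  -- of `M ⊗ P` from that of `P ⊗ M`.
  have m := Submodule.add_mem _ (Submodule.add_mem _ (Submodule.add_mem _
    (measurePrepare_smul_mem (tensorMap_mem_measurePrepare hP hP) (mul_nonneg hw q₁))
    (measurePrepare_smul_mem (tensorMap_mem_measurePrepare hP hM) (mul_nonneg hw q₂)))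
    (measurePrepare_smul_mem (tensorMap_mem_measurePrepare hM hP) (mul_nonneg hw q₃)))
    (measurePrepare_smul_mem (tensorMap_mem_measurePrepare hM hM) (mul_nonneg hw q₄))
  convert m using 1
  refine linearMap_ext_kronecker fun X Y => ?_
  have hd1 : (d + 1 : ℂ) ≠ 0 := by exact_mod_cast d.succ_ne_zero
  rw [LinearMap.comp_apply, h₁.comp_apply h₂, Fintype.card_fin]
  have hsub : ∀ Z : Matrix (Fin d) (Fin d) ℂ, ((d : ℂ) • traceMap (Fin d) - LinearMap.id :
      Matrix (Fin d) (Fin d) ℂ →ₗ[ℂ] Matrix (Fin d) (Fin d) ℂ) Z =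
      (d * Z.trace) • (1 : Matrix (Fin d) (Fin d) ℂ) + (-1 : ℂ) • Z := by
    intro Z
    rw [LinearMap.sub_apply, LinearMap.smul_apply, traceMap_apply, LinearMap.id_apply, smul_smul,
      neg_one_smul, sub_eq_add_neg]
  simp only [LinearMap.add_apply, LinearMap.smul_apply, tensorMap_kronecker, hsub,
    traceMap_apply, LinearMap.id_apply, add_kronecker, kronecker_add, smul_kronecker,
    kronecker_smul]
  push_cast
  match_scalars <;> field_simp <;> ring

theorem comp_mem_measurePrepare_of_subsingleton {m : Type*} [Fintype m] [DecidableEq m]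
    [Subsingleton m] {T₁ T₂ : Matrix m m ℂ →ₗ[ℂ] Matrix m m ℂ}
    (h₁ : IsCompletelyPositive T₁) (h₂ : IsCompletelyPositive T₂) :
    T₂ ∘ₗ T₁ ∈ measurePrepare m m := by
  rcases isEmpty_or_nonempty m with hm | ⟨⟨o⟩⟩
  · convert (measurePrepare m m).zero_mem
    exact LinearMap.ext fun X => Subsingleton.elim _ _
  have hpos : ∀ {T : Matrix m m ℂ →ₗ[ℂ] Matrix m m ℂ}, IsCompletelyPositive T →
      ∃ r : ℝ, 0 ≤ r ∧ ∀ X, T X = (r : ℂ) • X := by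
    intro T hT
    have h := hT.sum_single_nonneg (fun _ : Unit => o) (fun _ => o) (fun _ => 1)
    simp only [Finset.univ_unique, Finset.sum_singleton, star_one, one_mul] at h
    obtain ⟨hr, hi⟩ := Complex.nonneg_iff.mp h
    have hr' : T (single o o 1) o o = ((T (single o o 1) o o).re : ℂ) :=
      Complex.ext (by simp) (by simp [← hi])
    refine ⟨_, hr, fun X => ?_⟩
    have hX : X = X o o • single o o 1 := by
      ext i j
      simp [Subsingleton.elim i o, Subsingleton.elim j o]
    ext i j
    conv_lhs => rw [hX]
    rw [map_smul, Subsingleton.elim i o, Subsingleton.elim j o, Matrix.smul_apply,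
      Matrix.smul_apply, ← hr', smul_eq_mul, smul_eq_mul, mul_comm]
  obtain ⟨r, hr, hT₁⟩ := hpos h₁
  obtain ⟨s, hs, hT₂⟩ := hpos h₂
  convert measurePrepare_smul_mem (rankOneMap_mem (Pi.single o 1) (Pi.single o 1))
    (mul_nonneg hr hs)
  refine LinearMap.ext fun X => Matrix.ext fun i j => ?_
  rw [LinearMap.comp_apply, hT₁, hT₂, LinearMap.smul_apply, rankOneMap_apply,
    Subsingleton.elim i o, Subsingleton.elim j o]
  simp [vecMulVec_apply]
  ring

end PPTSquared

theorem mainTheorem12 (d : ℕ)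
    (T₁ T₂ : Matrix (Fin d × Fin d) (Fin d × Fin d) ℂ →ₗ[ℂ]
      Matrix (Fin d × Fin d) (Fin d × Fin d) ℂ)
    (hcp₁ : PPTSquared.IsCompletelyPositive T₁)
    (hcp₂ : PPTSquared.IsCompletelyPositive T₂)
    (hco₁ : PPTSquared.IsCompletelyCopositive T₁)
    (hco₂ : PPTSquared.IsCompletelyCopositive T₂)
    (hsym₁ : PPTSquared.HasUnitarySymmetry T₁)
    (hsym₂ : PPTSquared.HasUnitarySymmetry T₂) :
    PPTSquared.IsEntanglementBreaking (T₂ ∘ₗ T₁) := by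
  apply PPTSquared.isEntanglementBreaking_of_mem_measurePrepare
  rcases le_or_gt 2 d with hd | hd
  · obtain ⟨a, b, c, e, h₁, p₁⟩ := PPTSquared.exists_isPPTCoeff hd hcp₁ hco₁ hsym₁
    obtain ⟨A, B, C, E, h₂, p₂⟩ := PPTSquared.exists_isPPTCoeff hd hcp₂ hco₂ hsym₂
    exact PPTSquared.comp_mem_measurePrepare hd h₁ h₂ p₁ p₂
  · have : Subsingleton (Fin d) := Fin.subsingleton_iff_le_one.mpr (by omega)
    exact PPTSquared.comp_mem_measurePrepare_of_subsingleton hcp₁ hcp₂
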